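/- Let $F$ be a field of arbitrary characteristic and let $A$ be an octonion division algebra over $F$. That is, $A = Q \oplus Q\ell$, where $Q$ is a quaternion algebra over $F$ with canonical involution $q \mapsto \overline{q}$ and $\gamma \in F^\times$, with multiplication $$(q+r\ell)(s+t\ell) = qs + \gamma\,\overline{t}\,r + (tq + r\overline{s})\ell ,$$ and every nonzero element of $A$ is invertible. Extend the involution to $A$ by $\overline{q+r\ell} = \overline{q} - r\ell$. Let $A[x] = A \otimes_F F[x]$, so that $x$ is central in $A[x]$. For $f = a_n x^n + \dots + a_1 x + a_0 \in A[x]$ and $\lambda \in A$ put $f(\lambda) = a_n\lambda^n + \dots + a_1\lambda + a_0$, and let $R(f) = \{\lambda \in A : f(\lambda) = 0\}$. For $c \in A^\times$ put $fc = (a_n c)x^n + \dots + (a_1 c)x + a_0 c$. Let $\overline{f} = \overline{a_n}x^n + \dots + \overline{a_1}x + \overline{a_0}$, and let $C(f) = \overline{f}\cdot f$ be the companion polynomial of $f$. Then, for every $f \in A[x]$, $$\bigcup_{c \in A^\times} R(fc) = R(C(f)),$$ and this set is the union of the conjugacy classes of the roots of $f$, i.e. $$\bigcup_{c \in A^\times}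 R(fc) = \{\, q\lambda q^{-1} : \lambda \in R(f),\ q \in A^\times \,\}.$$ -/

import Mathlib

open scoped Quaternion TensorProduct

/-- The Cayley double `A = Q ⊕ Qℓ`, with `ℓ² = γ`, of `Q = ℍ[F,a,b,c]`, the algebra over `F` with
basis `1, i, j, ij` and relations `i² = a + b i`, `j² = c`, `j i = (b - i) j`.  The element
`q + r ℓ` is the pair `⟨q, r⟩`.  Under the nondegeneracy conditions
`OctonionAlgebra.Nondegenerate` this is an octonion algebra, and every octonion algebra over
`F` is of this form (one may take `b = 0` in characteristic not `2` and `b = 1` in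
characteristic `2`). -/
@[ext]
structure OctonionAlgebra (F : Type*) [Field F] (a b c γ : F) where
  /-- the component `q` of `q + r ℓ` -/
  fst : ℍ[F,a,b,c]
  /-- the component `r` of `q + r ℓ` -/
  snd : ℍ[F,a,b,c]

namespace OctonionAlgebra

/-- The polynomial `X² - b X - a` is separable and `c` is nonzero, which says that `ℍ[F,a,b,c]` is
a quaternion algebra (central simple of dimension 4) over `F`; and `γ` is nonzero. -/
def Nondegenerate {F : Type*} [Field F] (a b c γ : F) : Prop :=
  b ^ 2 + 4 * a ≠ 0 ∧ c ≠ 0 ∧ γ ≠ 0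

section Algebra

variable {F : Type*} [Field F] {a b c γ : F}

/-! ### The vector space structure -/

instance : Zero (OctonionAlgebra F a b c γ) := ⟨⟨0, 0⟩⟩
instance : One (OctonionAlgebra F a b c γ) := ⟨⟨1, 0⟩⟩
instance : Add (OctonionAlgebra F a b c γ) := ⟨fun x y => ⟨x.fst + y.fst, x.snd + y.snd⟩⟩
instance : Neg (OctonionAlgebra F a b c γ) := ⟨fun x => ⟨-x.fst, -x.snd⟩⟩
instance : Sub (OctonionAlgebra F a b c γ) := ⟨fun x y => ⟨x.fst - y.fst, x.snd - y.snd⟩⟩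
instance {S : Type*} [SMul S F] : SMul S (OctonionAlgebra F a b c γ) :=
  ⟨fun s x => ⟨s • x.fst, s • x.snd⟩⟩

/-- `(q + r ℓ)(s + t ℓ) = q s + γ t̄ r + (t q + r s̄) ℓ`. -/
instance : Mul (OctonionAlgebra F a b c γ) :=
  ⟨fun x y => ⟨x.fst * y.fst + γ • (star y.snd * x.snd), y.snd * x.fst + x.snd * star y.fst⟩⟩

/-- The canonical involution: the conjugate of `q + r ℓ` is `q̄ - r ℓ`. -/
instance : Star (OctonionAlgebra F a b c γ) := ⟨fun x => ⟨star x.fst, -x.snd⟩⟩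

@[simp] theorem fst_zero : (0 : OctonionAlgebra F a b c γ).fst = 0 := rfl
@[simp] theorem snd_zero : (0 : OctonionAlgebra F a b c γ).snd = 0 := rfl
@[simp] theorem fst_one : (1 : OctonionAlgebra F a b c γ).fst = 1 := rfl
@[simp] theorem snd_one : (1 : OctonionAlgebra F a b c γ).snd = 0 := rfl

@[simp] theorem fst_add (x y : OctonionAlgebra F a b c γ) : (x + y).fst = x.fst + y.fst := rfl
@[simp] theorem snd_add (x y : OctonionAlgebra F a b c γ) : (x + y).snd = x.snd + y.snd := rfl
@[simp] theorem fst_neg (x : OctonionAlgebra F a b c γ) : (-x).fst = -x.fst := rfl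
@[simp] theorem snd_neg (x : OctonionAlgebra F a b c γ) : (-x).snd = -x.snd := rfl
@[simp] theorem fst_sub (x y : OctonionAlgebra F a b c γ) : (x - y).fst = x.fst - y.fst := rfl
@[simp] theorem snd_sub (x y : OctonionAlgebra F a b c γ) : (x - y).snd = x.snd - y.snd := rfl

@[simp] theorem fst_smul {S : Type*} [SMul S F] (s : S) (x : OctonionAlgebra F a b c γ) :
    (s • x).fst = s • x.fst := rfl
@[simp] theorem snd_smul {S : Type*} [SMul S F] (s : S) (x : OctonionAlgebra F a b c γ) :
    (s • x).snd = s • x.snd := rfl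

@[simp] theorem fst_mul (x y : OctonionAlgebra F a b c γ) :
    (x * y).fst = x.fst * y.fst + γ • (star y.snd * x.snd) := rfl
@[simp] theorem snd_mul (x y : OctonionAlgebra F a b c γ) :
    (x * y).snd = y.snd * x.fst + x.snd * star y.fst := rfl

@[simp] theorem fst_star (x : OctonionAlgebra F a b c γ) : (star x).fst = star x.fst := rfl
@[simp] theorem snd_star (x : OctonionAlgebra F a b c γ) : (star x).snd = -x.snd := rfl

theorem toProd_injective : Function.Injective
    (fun x : OctonionAlgebra F a b c γ => (x.fst, x.snd)) := by
  intro x y h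
  simp only [Prod.mk.injEq] at h
  exact OctonionAlgebra.ext h.1 h.2

instance : AddCommGroup (OctonionAlgebra F a b c γ) :=
  toProd_injective.addCommGroup _ rfl (fun _ _ => rfl) (fun _ => rfl) (fun _ _ => rfl)
    (fun _ _ => rfl) (fun _ _ => rfl)

instance : Module F (OctonionAlgebra F a b c γ) where
  one_smul x := by ext1 <;> simp only [fst_smul, snd_smul, one_smul]
  mul_smul r s x := by ext1 <;> simp only [fst_smul, snd_smul, mul_smul]
  smul_zero r := by ext1 <;> simp only [fst_smul, snd_smul, fst_zero, snd_zero, smul_zero]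
  smul_add r x y := by ext1 <;> simp only [fst_smul, snd_smul, fst_add, snd_add, smul_add]
  add_smul r s x := by ext1 <;> simp only [fst_smul, snd_smul, fst_add, snd_add, add_smul]
  zero_smul x := by ext1 <;> simp only [fst_smul, snd_smul, fst_zero, snd_zero, zero_smul]

instance : NonAssocRing (OctonionAlgebra F a b c γ) where
  left_distrib x y z := by
    ext1 <;> simp only [fst_mul, snd_mul, fst_add, snd_add, mul_add, add_mul, star_add,
      smul_add] <;> abel
  right_distrib x y z := by
    ext1 <;> simp only [fst_mul, snd_mul, fst_add, snd_add, mul_add, add_mul,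
      smul_add] <;> abel
  zero_mul x := by
    ext1 <;> simp only [fst_mul, snd_mul, fst_zero, snd_zero, zero_mul, mul_zero, smul_zero,
      add_zero]
  mul_zero x := by
    ext1 <;> simp only [fst_mul, snd_mul, fst_zero, snd_zero, zero_mul, mul_zero, smul_zero,
      add_zero, star_zero]
  one_mul x := by
    ext1 <;> simp only [fst_mul, snd_mul, fst_one, snd_one, one_mul, mul_one, zero_mul, mul_zero,
      smul_zero, add_zero]
  mul_one x := by
    ext1 <;> simp only [fst_mul, snd_mul, fst_one, snd_one, mul_one, zero_mul,
      smul_zero, add_zero, zero_add, star_zero, star_one]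

theorem quaternion_star_smul (s : F) (q : ℍ[F,a,b,c]) : star (s • q) = s • star q := by
  ext <;> simp

instance : IsScalarTower F (OctonionAlgebra F a b c γ) (OctonionAlgebra F a b c γ) where
  smul_assoc s x y := by
    ext1 <;> simp only [smul_eq_mul, fst_mul, snd_mul, fst_smul, snd_smul, smul_mul_assoc,
      mul_smul_comm, smul_add, smul_comm s γ]

instance : SMulCommClass F (OctonionAlgebra F a b c γ) (OctonionAlgebra F a b c γ) where
  smul_comm s x y := by
    ext1 <;> simp only [smul_eq_mul, fst_mul, snd_mul, fst_smul, snd_smul, smul_mul_assoc,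
      mul_smul_comm, smul_add, smul_comm s γ, quaternion_star_smul]

/-- Powers, with `x ^ 0 = 1` and `x ^ (n + 1) = x ^ n * x`.  (Octonion algebras are
power-associative, so the bracketing is immaterial.) -/
instance : Pow (OctonionAlgebra F a b c γ) ℕ :=
  ⟨fun x n => Nat.rec 1 (fun _ y => y * x) n⟩

@[simp] theorem pow_zero' (x : OctonionAlgebra F a b c γ) : x ^ 0 = 1 := rfl
theorem pow_succ' (x : OctonionAlgebra F a b c γ) (n : ℕ) : x ^ (n + 1) = x ^ n * x := rfl

/-- The canonical involution as an `F`-linear map. -/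
def conjₗ : OctonionAlgebra F a b c γ →ₗ[F] OctonionAlgebra F a b c γ where
  toFun x := star x
  map_add' x y := by
    ext1
    · simp only [fst_star, fst_add, star_add]
    · simp only [snd_star, snd_add, neg_add]
  map_smul' s x := by
    ext1
    · simp only [fst_star, fst_smul, quaternion_star_smul, RingHom.id_apply]
    · simp only [snd_star, snd_smul, smul_neg, RingHom.id_apply]

end Algebra

/-! ### Invertible elements and conjugacy -/

section Conj

variable {F : Type*} [Field F] {a b c γ : F}

/-- `u` and `v` are inverse to each other. -/
def AreInverse (u v : OctonionAlgebra F a b c γ) : Prop := u * v = 1 ∧ v * u = 1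

variable (F a b c γ) in
/-- The set `A^×` of invertible elements. -/
def invertibles : Set (OctonionAlgebra F a b c γ) := {u | ∃ v, AreInverse u v}

variable (F a b c γ) in
/-- `A` is a division algebra: every nonzero element has an inverse. -/
def IsDivision : Prop := ∀ u : OctonionAlgebra F a b c γ, u ≠ 0 → u ∈ invertibles F a b c γ

/-- `μ = q λ q⁻¹` for some `q ∈ A^×`; here `x` is `λ`, `y` is `μ` and `r` is `q⁻¹`. -/
def Conjugate (x y : OctonionAlgebra F a b c γ) : Prop :=
  ∃ q r, AreInverse q r ∧ y = (q * x) * r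

/-- The conjugacy class of `x`. -/
def conjugacyClass (x : OctonionAlgebra F a b c γ) : Set (OctonionAlgebra F a b c γ) :=
  {y | Conjugate x y}

end Conj

/-! ### Polynomials -/

variable (F : Type*) [Field F] (a b c γ : F) in
/-- The polynomial algebra `A[x] = A ⊗ F[x]`, with the usual multiplication
`(u ⊗ p)(v ⊗ q) = u v ⊗ p q`. -/
abbrev Poly : Type _ := OctonionAlgebra F a b c γ ⊗[F] Polynomial F

section Poly

variable {F : Type*} [Field F] {a b c γ : F}

/-- Substitution `f ↦ f(l)`, the additive map with `u x^n ↦ u l^n`. -/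
noncomputable def eval (l : OctonionAlgebra F a b c γ) :
    Poly F a b c γ →ₗ[F] OctonionAlgebra F a b c γ :=
  TensorProduct.lift
    ((LinearMap.mul F (OctonionAlgebra F a b c γ)).compl₂ (Polynomial.smeval.linearMap F l))

/-- `f(l) = a_n l^n + ⋯ + a_1 l + a_0` for `f = a_n x^n + ⋯ + a_1 x + a_0`. -/
theorem eval_sum (l : OctonionAlgebra F a b c γ) (n : ℕ) (u : ℕ → OctonionAlgebra F a b c γ) :
    eval l (∑ i ∈ Finset.range (n + 1), u i ⊗ₜ[F] (Polynomial.X ^ i : Polynomial F)) =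
      ∑ i ∈ Finset.range (n + 1), u i * l ^ i := by
  simp [eval, map_sum]

/-- The set `R(f)` of roots of `f` in `A`. -/
def roots (f : Poly F a b c γ) : Set (OctonionAlgebra F a b c γ) := {l | eval l f = 0}

/-- The right scalar multiple `f u = (a_n u) x^n + ⋯ + (a_1 u) x + a_0 u`. -/
noncomputable def rightMul (f : Poly F a b c γ) (u : OctonionAlgebra F a b c γ) :
    Poly F a b c γ := f * (u ⊗ₜ[F] (1 : Polynomial F))

/-- The union over `u ∈ A^×` of the root sets of the right scalar multiples `f u`. -/
def RMR (f : Poly F a b c γ) : Set (OctonionAlgebra F a b c γ) :=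
  ⋃ u ∈ invertibles F a b c γ, roots (rightMul f u)

/-- The coefficientwise conjugate of `f`. -/
noncomputable def polyConj (f : Poly F a b c γ) : Poly F a b c γ :=
  LinearMap.rTensor (Polynomial F) conjₗ f

/-- The companion polynomial `C(f)`, the product of the conjugate of `f` with `f`. -/
noncomputable def companion (f : Poly F a b c γ) : Poly F a b c γ := polyConj f * f

end Poly

end OctonionAlgebra

/-! Fix `x` with trace `t` and norm `n`. Since `x² = t x - n`, the value `f(x)` is `A x + B`, where
`A X + B` is the remainder of `f` modulo `X² - t X + n`; it depends on `x` only through `t`, `n` and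
the last substitution. Each of the three sets turns out to consist of the `x` for which `HasRootData
A B t n` holds, that is, for which `A X + B` has a root `y` of trace `t` and norm `n`.

For conjugates of roots this holds because, in a division algebra, conjugacy is equality of trace
and norm. For the companion, the remainder has the scalar coefficients `N(A + B) - N(A) - N(B) + t
N(A)` and `N(B) - n N(A)`. For right multiples, the point is an element `u` with `(z u) x = (z y) u`
for every `z`, despite nonassociativity: then `(A u) x + B u = (A y + B) u = 0`. Conversely,
multiplicativity of `N` lets `u` be cancelled from the norm conditions. -/

namespace OctonionAlgebra

/-! ### Norm, trace and the alternative laws, in coordinates -/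

section Norm

variable {F : Type*} [Field F] {a b c γ : F}

/-- The norm form of a quaternion algebra. -/
def quaternionNorm (q : ℍ[F,a,b,c]) : F :=
  q.re ^ 2 + b * q.re * q.imI - a * q.imI ^ 2
    - c * (q.imJ ^ 2 + b * q.imJ * q.imK - a * q.imK ^ 2)

/-- The norm form of the Cayley double. -/
def norm (x : OctonionAlgebra F a b c γ) : F := quaternionNorm x.fst - γ * quaternionNorm x.snd

/-- The trace form of the Cayley double. -/
def trace (x : OctonionAlgebra F a b c γ) : F := 2 * x.fst.re + b * x.fst.imI

set_option maxHeartbeats 4000000 in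
theorem norm_mul (x y : OctonionAlgebra F a b c γ) : norm (x * y) = norm x * norm y := by
  simp [norm, quaternionNorm]
  ring

theorem norm_one : norm (1 : OctonionAlgebra F a b c γ) = 1 := by
  simp [norm, quaternionNorm]

theorem norm_smul (s : F) (x : OctonionAlgebra F a b c γ) : norm (s • x) = s ^ 2 * norm x := by
  simp [norm, quaternionNorm]
  ring

theorem norm_neg (x : OctonionAlgebra F a b c γ) : norm (-x) = norm x := by
  simp [norm, quaternionNorm]

theorem star_eq (x : OctonionAlgebra F a b c γ) : star x = trace x • 1 - x := by
  ext <;> simp [trace] <;> ring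

theorem mul_self_eq (x : OctonionAlgebra F a b c γ) : x * x = trace x • x - norm x • 1 := by
  ext <;> simp [trace, norm, quaternionNorm] <;> ring

set_option maxHeartbeats 4000000 in
theorem mul_mul_self (x y : OctonionAlgebra F a b c γ) : x * y * y = x * (y * y) := by
  ext <;> simp only [fst_mul, snd_mul, QuaternionAlgebra.re_add, QuaternionAlgebra.imI_add,
    QuaternionAlgebra.imJ_add, QuaternionAlgebra.imK_add, QuaternionAlgebra.re_mul,
    QuaternionAlgebra.imI_mul, QuaternionAlgebra.imJ_mul, QuaternionAlgebra.imK_mul,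
    QuaternionAlgebra.re_star, QuaternionAlgebra.imI_star, QuaternionAlgebra.imJ_star,
    QuaternionAlgebra.imK_star, QuaternionAlgebra.re_smul, QuaternionAlgebra.imI_smul,
    QuaternionAlgebra.imJ_smul, QuaternionAlgebra.imK_smul, smul_eq_mul] <;> ring

set_option maxHeartbeats 4000000 in
theorem self_mul_mul (x y : OctonionAlgebra F a b c γ) : y * (y * x) = y * y * x := by
  ext <;> simp only [fst_mul, snd_mul, QuaternionAlgebra.re_add, QuaternionAlgebra.imI_add,
    QuaternionAlgebra.imJ_add, QuaternionAlgebra.imK_add, QuaternionAlgebra.re_mul,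
    QuaternionAlgebra.imI_mul, QuaternionAlgebra.imJ_mul, QuaternionAlgebra.imK_mul,
    QuaternionAlgebra.re_star, QuaternionAlgebra.imI_star, QuaternionAlgebra.imJ_star,
    QuaternionAlgebra.imK_star, QuaternionAlgebra.re_smul, QuaternionAlgebra.imI_smul,
    QuaternionAlgebra.imJ_smul, QuaternionAlgebra.imK_smul, smul_eq_mul] <;> ring

end Norm

/-! ### Consequences of alternativity; inverses -/

section Alternative

variable {F : Type*} [Field F] {a b c γ : F}

theorem norm_one_sub (x : OctonionAlgebra F a b c γ) : norm (1 - x) = 1 - trace x + norm x := by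
  simp [norm, trace, quaternionNorm]
  ring

theorem norm_smul_add (s : F) (x y : OctonionAlgebra F a b c γ) :
    norm (s • x + y) = s ^ 2 * norm x + s * (norm (x + y) - norm x - norm y) + norm y := by
  simp [norm, quaternionNorm]
  ring

theorem norm_smul_one (s : F) : norm (s • (1 : OctonionAlgebra F a b c γ)) = s ^ 2 := by
  rw [norm_smul, norm_one, mul_one]

theorem trace_smul_one (s : F) : trace (s • (1 : OctonionAlgebra F a b c γ)) = 2 * s := by
  simp [trace]

theorem smul_one_eq_zero_iff {s : F} : s • (1 : OctonionAlgebra F a b c γ) = 0 ↔ s = 0 :=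
  smul_eq_zero.trans (or_iff_left fun h => one_ne_zero (congrArg fst h))

theorem star_add (x y : OctonionAlgebra F a b c γ) : star (x + y) = star x + star y :=
  map_add conjₗ x y

theorem star_mul_self (x : OctonionAlgebra F a b c γ) : star x * x = norm x • 1 := by
  rw [star_eq, sub_mul, mul_self_eq, smul_mul_assoc, one_mul, sub_sub_cancel]

theorem mul_star_self (x : OctonionAlgebra F a b c γ) : x * star x = norm x • 1 := by
  rw [star_eq, mul_sub, mul_self_eq, mul_smul_comm, mul_one, sub_sub_cancel]

theorem star_mul_add_star_mul (x y : OctonionAlgebra F a b c γ) :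
    star x * y + star y * x = (norm (x + y) - norm x - norm y) • 1 := by
  rw [sub_smul, sub_smul, ← star_mul_self, ← star_mul_self, ← star_mul_self, star_add, add_mul,
    mul_add, mul_add]
  abel

theorem mul_mul_star (x y : OctonionAlgebra F a b c γ) : x * y * star y = norm y • x := by
  rw [star_eq, mul_sub, mul_mul_self, mul_self_eq, mul_sub, mul_smul_comm, mul_smul_comm,
    mul_smul_comm, mul_one, mul_one, sub_sub_cancel]

theorem mul_star_mul (x y : OctonionAlgebra F a b c γ) : x * (star x * y) = norm x • y := by
  rw [star_eq, sub_mul, mul_sub, self_mul_mul, mul_self_eq, sub_mul, smul_mul_assoc,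
    smul_mul_assoc, smul_mul_assoc, mul_smul_comm, one_mul, sub_sub_cancel]

/-- Linearisation of the right alternative law. -/
theorem mul_mul_add_mul_mul (x y z : OctonionAlgebra F a b c γ) :
    x * y * z + x * z * y = x * (y * z + z * y) := by
  have h := mul_mul_self x (y + z)
  simp only [mul_add, add_mul, mul_mul_self] at h
  rw [mul_add]
  rw [← sub_eq_zero] at h ⊢
  rw [← h]
  abel

theorem areInverse_of_norm_ne_zero {x : OctonionAlgebra F a b c γ} (h : norm x ≠ 0) :
    AreInverse x ((norm x)⁻¹ • star x) := by
  constructor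
  · rw [mul_smul_comm, mul_star_self, inv_smul_smul₀ h]
  · rw [smul_mul_assoc, star_mul_self, inv_smul_smul₀ h]

theorem AreInverse.norm_mul_norm {x y : OctonionAlgebra F a b c γ} (h : AreInverse x y) :
    norm x * norm y = 1 := by
  rw [← norm_mul, h.1, norm_one]

theorem norm_ne_zero_of_mem_invertibles {x : OctonionAlgebra F a b c γ}
    (h : x ∈ invertibles F a b c γ) : norm x ≠ 0 :=
  h.elim fun _ hy => left_ne_zero_of_mul_eq_one hy.norm_mul_norm

theorem norm_eq_zero_iff (hdiv : IsDivision F a b c γ) {x : OctonionAlgebra F a b c γ} :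
    norm x = 0 ↔ x = 0 := by
  refine ⟨fun h => by_contra fun hx => norm_ne_zero_of_mem_invertibles (hdiv x hx) h, ?_⟩
  rintro rfl
  simp [norm, quaternionNorm]

end Alternative

/-! ### Conjugacy, trace and norm -/

section Conjugation

variable {F : Type*} [Field F] {a b c γ : F}

theorem Conjugate.norm_eq {x y : OctonionAlgebra F a b c γ} (h : Conjugate x y) :
    norm y = norm x := by
  obtain ⟨q, r, hqr, rfl⟩ := h
  rw [norm_mul, norm_mul]
  linear_combination norm x * hqr.norm_mul_norm

theorem Conjugate.trace_eq {x y : OctonionAlgebra F a b c γ} (h : Conjugate x y) :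
    trace y = trace x := by
  have hn := h.norm_eq
  obtain ⟨q, r, hqr, rfl⟩ := h
  -- The trace is recovered from norms by `N(1 - x) = 1 - t + n`.
  have key : norm (1 - q * x * r) = norm (1 - x) := by
    rw [show 1 - q * x * r = q * (1 - x) * r by rw [mul_sub, sub_mul, mul_one, hqr.1],
      norm_mul, norm_mul]
    linear_combination norm (1 - x) * hqr.norm_mul_norm
  rw [norm_one_sub, norm_one_sub] at key
  linear_combination hn - key

/-- A nonzero element conjugating `x` to its conjugate `star x`. -/
theorem exists_mul_eq_star_mul (hnd : Nondegenerate a b c γ) (x : OctonionAlgebra F a b c γ) :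
    ∃ u : OctonionAlgebra F a b c γ, u ≠ 0 ∧ u * x = star x * u := by
  obtain ⟨p, s⟩ := x
  by_cases hs : s = 0
  · subst hs
    -- For `x` in `Q` take `u = ℓ`, since `ℓ p = p̄ ℓ`.
    refine ⟨⟨0, 1⟩, fun h => one_ne_zero (congrArg snd h), ?_⟩
    ext1 <;> simp
  -- A traceless `u` works once it is orthogonal to `x`. Here `u = (s j) ℓ`, and `s j` is orthogonal
  -- to `s` because `j` has trace zero; `j² = c ≠ 0` keeps it nonzero.
  · refine ⟨⟨0, s * ⟨0, 0, 1, 0⟩⟩, fun h => hs ?_, ?_⟩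
    · have h1 : s * ⟨0, 0, 1, 0⟩ = 0 := congrArg snd h
      have hc := hnd.2.1
      have h2 : c • s = s * ⟨0, 0, 1, 0⟩ * ⟨0, 0, 1, 0⟩ := by
        ext <;> simp
      rw [h1, zero_mul] at h2
      exact (smul_eq_zero.mp h2).resolve_left hc
    · ext <;> simp <;> ring

/-- Elements of equal trace and norm are conjugate, by an element that does not see the brackets
in a further left factor. -/
theorem exists_mul_mul_eq_mul_mul (hnd : Nondegenerate a b c γ)
    {x y : OctonionAlgebra F a b c γ} (ht : trace x = trace y) (hn : norm x = norm y) :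
    ∃ u : OctonionAlgebra F a b c γ, u ≠ 0 ∧ ∀ z, z * u * x = z * y * u := by
  by_cases h : y = star x
  · obtain ⟨u, hu, hux⟩ := exists_mul_eq_star_mul hnd x
    refine ⟨u, hu, fun z => ?_⟩
    -- As `u x + x u = (x̄ + x) u = t u`, linearised alternativity gives `(z u) x = t (z u) - (z x)
    -- u = (z x̄) u`.
    have h1 := mul_mul_add_mul_mul z u x
    rw [hux, ← add_mul, star_eq, sub_add_cancel, smul_mul_assoc, one_mul, mul_smul_comm] at h1
    rw [h, star_eq, mul_sub, sub_mul, mul_smul_comm, smul_mul_assoc, mul_one, ← h1,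
      add_sub_cancel_right]
  -- With `u = y - x̄`, both sides equal `(z y) x - n z`.
  · refine ⟨y - star x, sub_ne_zero.mpr h, fun z => ?_⟩
    rw [mul_sub, sub_mul, mul_sub, mul_mul_self, mul_self_eq y, star_eq, ← ht, ← hn]
    simp only [mul_sub, sub_mul, mul_smul_comm, smul_mul_assoc, mul_one, mul_mul_self,
      mul_self_eq x]
    abel

theorem conjugate_of_mul_eq {x y u : OctonionAlgebra F a b c γ} (hu : norm u ≠ 0)
    (h : u * x = y * u) : Conjugate x y :=
  ⟨u, _, areInverse_of_norm_ne_zero hu, by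
    rw [h, mul_smul_comm, mul_mul_star, inv_smul_smul₀ hu]⟩

theorem conjugate_of_trace_eq_of_norm_eq (hnd : Nondegenerate a b c γ)
    (hdiv : IsDivision F a b c γ) {x y : OctonionAlgebra F a b c γ} (ht : trace x = trace y)
    (hn : norm x = norm y) : Conjugate x y := by
  obtain ⟨u, hu, h⟩ := exists_mul_mul_eq_mul_mul hnd ht hn
  refine conjugate_of_mul_eq ((norm_eq_zero_iff hdiv).not.mpr hu) ?_
  simpa only [one_mul] using h 1

end Conjugation

/-! ### Roots of linear polynomials with prescribed trace and norm -/

section Reduction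

variable {F : Type*} [Field F] {a b c γ : F}

/-- `N(A + B) = (1 - t + n) N(A)` and `N(B) = n N(A)`: the condition under which `A x + B` has a
root of trace `t` and norm `n`. -/
def HasRootData (A B : OctonionAlgebra F a b c γ) (t n : F) : Prop :=
  norm (A + B) = (1 - t + n) * norm A ∧ norm B = n * norm A

theorem hasRootData_of_mul_add_eq_zero {A B x : OctonionAlgebra F a b c γ} (h : A * x + B = 0) :
    HasRootData A B (trace x) (norm x) := by
  obtain rfl : B = -(A * x) := eq_neg_of_add_eq_zero_right h
  constructor
  · rw [← sub_eq_add_neg, ← norm_one_sub,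
      show A - A * x = A * (1 - x) by rw [mul_sub, mul_one], norm_mul, mul_comm]
  · rw [norm_neg, norm_mul, mul_comm]

theorem HasRootData.of_mul_right {A B u : OctonionAlgebra F a b c γ} {t n : F} (hu : norm u ≠ 0)
    (h : HasRootData (A * u) (B * u) t n) : HasRootData A B t n := by
  obtain ⟨h1, h2⟩ := h
  rw [← add_mul, norm_mul, norm_mul, ← mul_assoc] at h1
  rw [norm_mul, norm_mul, ← mul_assoc] at h2
  exact ⟨mul_right_cancel₀ hu h1, mul_right_cancel₀ hu h2⟩

/-- If `A ≠ 0`, the root is `y = -A⁻¹ B`; the two conditions determine `N(y)` and `N(1 - y)`, hence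
its trace. -/
theorem HasRootData.exists_root (hdiv : IsDivision F a b c γ) {A B x : OctonionAlgebra F a b c γ}
    (h : HasRootData A B (trace x) (norm x)) :
    ∃ y, A * y + B = 0 ∧ trace y = trace x ∧ norm y = norm x := by
  obtain ⟨h1, h2⟩ := h
  by_cases hA : A = 0
  · subst hA
    rw [(norm_eq_zero_iff hdiv).mpr rfl, mul_zero, norm_eq_zero_iff hdiv] at h2
    -- Both coefficients vanish, so `x` itself serves as the root.
    exact ⟨x, by rw [zero_mul, h2, add_zero], rfl, rfl⟩
  · have hN : norm A ≠ 0 := (norm_eq_zero_iff hdiv).not.mpr hA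
    obtain ⟨y, hy⟩ : ∃ y, A * y + B = 0 :=
      ⟨-((norm A)⁻¹ • (star A * B)), by
        rw [mul_neg, mul_smul_comm, mul_star_mul, inv_smul_smul₀ hN, neg_add_cancel]⟩
    obtain ⟨h3, h4⟩ := hasRootData_of_mul_add_eq_zero hy
    have hn : norm y = norm x := mul_right_cancel₀ hN (h4.symm.trans h2)
    have ht := mul_right_cancel₀ hN (h3.symm.trans h1)
    exact ⟨y, hy, by linear_combination hn - ht, hn⟩

/-- If `x` is not a scalar, `x` and `1` are independent and both coefficients vanish. If `x = s`,
the left side is `N(s A + B)`, and anisotropy gives `A x + B = 0`. -/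
theorem smul_add_smul_one_eq_zero_iff (hdiv : IsDivision F a b c γ)
    (A B x : OctonionAlgebra F a b c γ) :
    (norm (A + B) - norm A - norm B + trace x * norm A) • x +
        (norm B - norm x * norm A) • (1 : OctonionAlgebra F a b c γ) = 0 ↔
      HasRootData A B (trace x) (norm x) := by
  constructor
  · intro h
    by_cases hτ : norm (A + B) - norm A - norm B + trace x * norm A = 0
    · rw [hτ, zero_smul, zero_add, smul_one_eq_zero_iff] at h
      exact ⟨by linear_combination hτ + h, by linear_combination h⟩
    · obtain ⟨s, rfl⟩ : ∃ s : F, x = s • 1 := by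
        refine ⟨-((norm (A + B) - norm A - norm B + trace x * norm A)⁻¹ *
          (norm B - norm x * norm A)), ?_⟩
        rw [neg_smul, mul_smul, ← smul_neg, eq_inv_smul_iff₀ hτ]
        exact eq_neg_of_add_eq_zero_left h
      rw [smul_smul, ← add_smul, smul_one_eq_zero_iff, trace_smul_one,
        norm_smul_one] at h
      apply hasRootData_of_mul_add_eq_zero
      rw [mul_smul_comm, mul_one, ← norm_eq_zero_iff hdiv, norm_smul_add]
      linear_combination h
  · rintro ⟨h1, h2⟩
    rw [show norm (A + B) - norm A - norm B + trace x * norm A = 0 by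
        linear_combination h1 - h2, show norm B - norm x * norm A = 0 by
        linear_combination h2, zero_smul, zero_smul, add_zero]

end Reduction

/-! ### Remainders modulo `X² - t X + n`, computed by `X ↦ ω` with `ω² = t ω - n` -/

section Remainder

variable {F : Type*} [Field F] {a b c γ : F}

/-- The coefficient of `x` in the remainder of `f` by `x² - t x + n`. -/
noncomputable def remLin (t n : F) : Poly F a b c γ →ₗ[F] OctonionAlgebra F a b c γ :=
  TensorProduct.lift ((LinearMap.lsmul F (OctonionAlgebra F a b c γ)).flip.compl₂
    (QuadraticAlgebra.imₗ (-n) t ∘ₗ (Polynomial.aeval QuadraticAlgebra.omega).toLinearMap))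

/-- The constant term of the remainder of `f` by `x² - t x + n`. -/
noncomputable def remConst (t n : F) : Poly F a b c γ →ₗ[F] OctonionAlgebra F a b c γ :=
  TensorProduct.lift ((LinearMap.lsmul F (OctonionAlgebra F a b c γ)).flip.compl₂
    (QuadraticAlgebra.reₗ (-n) t ∘ₗ (Polynomial.aeval QuadraticAlgebra.omega).toLinearMap))

theorem remLin_tmul (t n : F) (u : OctonionAlgebra F a b c γ) (p : Polynomial F) :
    remLin t n (u ⊗ₜ p) =
      (Polynomial.aeval (QuadraticAlgebra.omega : QuadraticAlgebra F (-n) t) p).im • u := rfl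

theorem remConst_tmul (t n : F) (u : OctonionAlgebra F a b c γ) (p : Polynomial F) :
    remConst t n (u ⊗ₜ p) =
      (Polynomial.aeval (QuadraticAlgebra.omega : QuadraticAlgebra F (-n) t) p).re • u := rfl

theorem smeval_eq (x : OctonionAlgebra F a b c γ) (p : Polynomial F) :
    p.smeval x =
      (Polynomial.aeval (QuadraticAlgebra.omega :
        QuadraticAlgebra F (-norm x) (trace x)) p).im • x +
      (Polynomial.aeval (QuadraticAlgebra.omega :
        QuadraticAlgebra F (-norm x) (trace x)) p).re • 1 := by
  have key (k : ℕ) : x ^ k =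
      ((QuadraticAlgebra.omega : QuadraticAlgebra F (-norm x) (trace x)) ^ k).im • x +
      ((QuadraticAlgebra.omega : QuadraticAlgebra F (-norm x) (trace x)) ^ k).re • 1 := by
    induction k with
    | zero => simp [QuadraticAlgebra.re_one, QuadraticAlgebra.im_one]
    | succ k ih =>
      rw [pow_succ', ih, pow_succ, add_mul, smul_mul_assoc, smul_mul_assoc, one_mul, mul_self_eq,
        QuadraticAlgebra.im_mul, QuadraticAlgebra.re_mul, QuadraticAlgebra.omega_re,
        QuadraticAlgebra.omega_im]
      module
  induction p using Polynomial.induction_on' with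
  | add p q hp hq =>
    rw [Polynomial.smeval_add, hp, hq, map_add, QuadraticAlgebra.im_add, QuadraticAlgebra.re_add]
    module
  | monomial k s =>
    rw [Polynomial.smeval_monomial, key, Polynomial.aeval_monomial, ← Algebra.smul_def,
      QuadraticAlgebra.im_smul, QuadraticAlgebra.re_smul, smul_add, smul_assoc, smul_assoc]

theorem eval_eq (x : OctonionAlgebra F a b c γ) (f : Poly F a b c γ) :
    eval x f = remLin (trace x) (norm x) f * x + remConst (trace x) (norm x) f := by
  induction f using TensorProduct.induction_on with
  | zero => simp
  | add f g hf hg => rw [map_add, map_add, map_add, hf, hg, add_mul]; abel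
  | tmul u p =>
    change u * p.smeval x = _
    rw [smeval_eq, remLin_tmul, remConst_tmul, mul_add, mul_smul_comm, mul_smul_comm, mul_one,
      smul_mul_assoc]

theorem remLin_mul (t n : F) (f g : Poly F a b c γ) :
    remLin t n (f * g) = remLin t n f * remConst t n g + remConst t n f * remLin t n g +
      t • (remLin t n f * remLin t n g) := by
  induction f using TensorProduct.induction_on with
  | zero => simp
  | add f₁ f₂ h₁ h₂ => simp only [add_mul, map_add, h₁, h₂, smul_add]; abel
  | tmul u p =>
    induction g using TensorProduct.induction_on with
    | zero => simp
    | add g₁ g₂ h₁ h₂ => simp only [mul_add, map_add, h₁, h₂, smul_add]; abel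
    | tmul v q =>
      simp only [Algebra.TensorProduct.tmul_mul_tmul, remLin_tmul, remConst_tmul, map_mul,
        QuadraticAlgebra.im_mul, smul_mul_assoc, mul_smul_comm]
      module

theorem remConst_mul (t n : F) (f g : Poly F a b c γ) :
    remConst t n (f * g) = remConst t n f * remConst t n g -
      n • (remLin t n f * remLin t n g) := by
  induction f using TensorProduct.induction_on with
  | zero => simp
  | add f₁ f₂ h₁ h₂ => simp only [add_mul, map_add, h₁, h₂, smul_add]; abel
  | tmul u p =>
    induction g using TensorProduct.induction_on with
    | zero => simp
    | add g₁ g₂ h₁ h₂ => simp only [mul_add, map_add, h₁, h₂, smul_add]; abel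
    | tmul v q =>
      simp only [Algebra.TensorProduct.tmul_mul_tmul, remLin_tmul, remConst_tmul, map_mul,
        QuadraticAlgebra.re_mul, smul_mul_assoc, mul_smul_comm]
      module

theorem remLin_polyConj (t n : F) (f : Poly F a b c γ) :
    remLin t n (polyConj f) = star (remLin t n f) := by
  change _ = conjₗ (remLin t n f)
  induction f using TensorProduct.induction_on with
  | zero => simp [polyConj]
  | add f g hf hg => simp only [polyConj, map_add] at hf hg ⊢; rw [hf, hg]
  | tmul u p => rw [polyConj, LinearMap.rTensor_tmul, remLin_tmul, remLin_tmul, map_smul]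

theorem remConst_polyConj (t n : F) (f : Poly F a b c γ) :
    remConst t n (polyConj f) = star (remConst t n f) := by
  change _ = conjₗ (remConst t n f)
  induction f using TensorProduct.induction_on with
  | zero => simp [polyConj]
  | add f g hf hg => simp only [polyConj, map_add] at hf hg ⊢; rw [hf, hg]
  | tmul u p => rw [polyConj, LinearMap.rTensor_tmul, remConst_tmul, remConst_tmul, map_smul]

theorem remLin_rightMul (t n : F) (f : Poly F a b c γ) (u : OctonionAlgebra F a b c γ) :
    remLin t n (rightMul f u) = remLin t n f * u := by
  simp [rightMul, remLin_mul, remLin_tmul, remConst_tmul, QuadraticAlgebra.re_one,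
    QuadraticAlgebra.im_one]

theorem remConst_rightMul (t n : F) (f : Poly F a b c γ) (u : OctonionAlgebra F a b c γ) :
    remConst t n (rightMul f u) = remConst t n f * u := by
  simp [rightMul, remConst_mul, remLin_tmul, remConst_tmul, QuadraticAlgebra.re_one,
    QuadraticAlgebra.im_one]

end Remainder

/-! ### The three sets have the same description -/

section Roots

variable {F : Type*} [Field F] {a b c γ : F}

/-- The remainder is that of `(Ā X + B̄)(A X + B)`, whose coefficients `N(A)`, `Ā B + B̄ A`, `N(B)`
are scalars. -/
theorem eval_companion (x : OctonionAlgebra F a b c γ) (f : Poly F a b c γ) :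
    eval x (companion f) =
      (norm (remLin (trace x) (norm x) f + remConst (trace x) (norm x) f) -
        norm (remLin (trace x) (norm x) f) - norm (remConst (trace x) (norm x) f) +
        trace x * norm (remLin (trace x) (norm x) f)) • x +
      (norm (remConst (trace x) (norm x) f) -
        norm x * norm (remLin (trace x) (norm x) f)) • (1 : OctonionAlgebra F a b c γ) := by
  rw [eval_eq, companion, remLin_mul, remConst_mul, remLin_polyConj, remConst_polyConj,
    star_mul_add_star_mul, star_mul_self, star_mul_self, smul_smul, smul_smul, ← add_smul,
    ← sub_smul, smul_mul_assoc, one_mul]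

theorem mem_roots_companion_iff (hdiv : IsDivision F a b c γ) (f : Poly F a b c γ)
    (x : OctonionAlgebra F a b c γ) :
    x ∈ roots (companion f) ↔ HasRootData (remLin (trace x) (norm x) f)
      (remConst (trace x) (norm x) f) (trace x) (norm x) := by
  change eval x (companion f) = 0 ↔ _
  rw [eval_companion, smul_add_smul_one_eq_zero_iff hdiv]

theorem mem_RMR_iff (hnd : Nondegenerate a b c γ) (hdiv : IsDivision F a b c γ)
    (f : Poly F a b c γ) (x : OctonionAlgebra F a b c γ) :
    x ∈ RMR f ↔ HasRootData (remLin (trace x) (norm x) f)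
      (remConst (trace x) (norm x) f) (trace x) (norm x) := by
  simp only [RMR, Set.mem_iUnion, exists_prop, roots, Set.mem_ofPred_eq, eval_eq,
    remLin_rightMul, remConst_rightMul]
  constructor
  · rintro ⟨u, hu, h⟩
    exact (hasRootData_of_mul_add_eq_zero h).of_mul_right (norm_ne_zero_of_mem_invertibles hu)
  · intro h
    obtain ⟨y, hy, ht, hn⟩ := h.exists_root hdiv
    obtain ⟨u, hu, hux⟩ := exists_mul_mul_eq_mul_mul hnd ht.symm hn.symm
    exact ⟨u, hdiv u hu, by rw [hux, ← add_mul, hy, zero_mul]⟩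

theorem mem_iUnion_conjugacyClass_iff (hnd : Nondegenerate a b c γ) (hdiv : IsDivision F a b c γ)
    (f : Poly F a b c γ) (x : OctonionAlgebra F a b c γ) :
    x ∈ ⋃ l ∈ roots f, conjugacyClass l ↔ HasRootData (remLin (trace x) (norm x) f)
      (remConst (trace x) (norm x) f) (trace x) (norm x) := by
  simp only [Set.mem_iUnion, exists_prop, roots, conjugacyClass, Set.mem_ofPred_eq, eval_eq]
  constructor
  · rintro ⟨y, hy, h⟩
    rw [h.trace_eq, h.norm_eq]
    exact hasRootData_of_mul_add_eq_zero hy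
  · intro h
    obtain ⟨y, hy, ht, hn⟩ := h.exists_root hdiv
    exact ⟨y, by rwa [ht, hn], conjugate_of_trace_eq_of_norm_eq hnd hdiv ht hn⟩

end Roots

end OctonionAlgebra

theorem mainTheorem1 {F : Type*} [Field F] (a b c γ : F)
    (hnd : OctonionAlgebra.Nondegenerate a b c γ)
    (hdiv : OctonionAlgebra.IsDivision F a b c γ)
    (f : OctonionAlgebra.Poly F a b c γ) :
    OctonionAlgebra.RMR f = OctonionAlgebra.roots (OctonionAlgebra.companion f) ∧
      OctonionAlgebra.RMR f =
        ⋃ l ∈ OctonionAlgebra.roots f, OctonionAlgebra.conjugacyClass l := by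
  constructor <;> ext x
  · rw [OctonionAlgebra.mem_RMR_iff hnd hdiv, OctonionAlgebra.mem_roots_companion_iff hdiv]
  · rw [OctonionAlgebra.mem_RMR_iff hnd hdiv,
      OctonionAlgebra.mem_iUnion_conjugacyClass_iff hnd hdiv]
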